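/- Let $G\subset S_N^+$ be a closed quantum subgroup, with magic unitary $u=(u_{ij})_{i,j=1}^N$: thus $C(G)$ is a nonzero unital $C^*$-algebra generated by the entries of $u$, these entries are projections summing up to $1$ on each row and each column, and $\Delta(u_{ij})=\sum_l u_{il}\otimes u_{lj}$ defines a morphism of $C^*$-algebras $\Delta:C(G)\to C(G)\otimes_{\min} C(G)$. Let $\int_G:C(G)\to\mathbb C$ be the Haar integration, that is, the unique left and right invariant state. For $k\in\mathbb N$ let $$J_N^k=\left\{(i_1,\ldots,i_k)\in\{1,\ldots,N\}^k\ \Big|\ i_r\neq i_{r+1}\text{ for all }1\le r<k\right\},$$ and assume that $J_N^k\neq\emptyset$ (which is automatic for $N\geq2$). Let $\mathrm{span}(J_N^k)\subset(\mathbb C^N)^{\otimes k}$ be the span of the vectors $e_{i_1\ldots i_k}=e_{i_1}\otimes\cdots\otimes e_{i_k}$ with $i\in J_N^k$, and consider the coaction $\Phi:\mathrm{span}(J_N^k)\to C(G)\otimes\mathrm{span}(J_N^k)$ given by $$\Phi(e_{i_1\ldots i_k})=\sum_{j\in J_N^k}u_{i_1j_1}\cdots u_{i_kj_k}\otimes e_{j_1\ldots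 j_k}.$$ Then $\eta=\sum_{i\in J_N^k}e_{i_1\ldots i_k}$ satisfies $\Phi(\eta)=1\otimes\eta$, and the following conditions are equivalent: 1. $\mathrm{Fix}(\Phi)=\{\xi\in\mathrm{span}(J_N^k)\mid\Phi(\xi)=1\otimes\xi\}$ is $1$-dimensional. 2. $\mathrm{Fix}(\Phi)=\mathbb C\eta$. 3. $\displaystyle\sum_{i\in J_N^k}\int_Gu_{i_1i_1}\cdots u_{i_ki_k}=1$. -/

import Mathlib

open scoped TensorProduct ComplexOrder

/-- A magic unitary: a square matrix over a `C⋆`-algebra whose entries are projections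
(`p = p⋆ = p²`), summing up to `1` on each row and on each column. -/
structure IsMagicUnitary {N : ℕ} {A : Type*} [CStarAlgebra A] (u : Matrix (Fin N) (Fin N) A) :
    Prop where
  projection : ∀ i j, IsStarProjection (u i j)
  row_sum : ∀ i, ∑ j, u i j = 1
  col_sum : ∀ j, ∑ i, u i j = 1

/-- A state of a unital `C⋆`-algebra: a positive linear functional with value `1` at the unit. -/
structure IsState {A : Type*} [CStarAlgebra A] (φ : A →L[ℂ] ℂ) : Prop where
  map_one : φ 1 = 1
  nonneg : ∀ a : A, 0 ≤ φ (star a * a)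

section Functionals

variable {A : Type*} [CStarAlgebra A]

/-- The functional `φ ⊗ ψ` on the algebraic tensor product. -/
noncomputable def tensorFunctional (φ ψ : A →L[ℂ] ℂ) : A ⊗[ℂ] A →ₗ[ℂ] ℂ :=
  (TensorProduct.lid ℂ ℂ).toLinearMap ∘ₗ TensorProduct.map φ.toLinearMap ψ.toLinearMap

/-- The slice map `φ ⊗ id`. -/
noncomputable def sliceLeft (φ : A →L[ℂ] ℂ) : A ⊗[ℂ] A →ₗ[ℂ] A :=
  (TensorProduct.lid ℂ A).toLinearMap ∘ₗ TensorProduct.map φ.toLinearMap LinearMap.id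

/-- The slice map `id ⊗ φ`. -/
noncomputable def sliceRight (φ : A →L[ℂ] ℂ) : A ⊗[ℂ] A →ₗ[ℂ] A :=
  (TensorProduct.rid ℂ A).toLinearMap ∘ₗ TensorProduct.map LinearMap.id φ.toLinearMap

/-- `‖x‖ ≤ C` for the minimal (spatial) `C⋆`-norm of the algebraic tensor product `A ⊗ A`, which is
`‖x‖² = sup (φ ⊗ ψ)(y⋆x⋆xy) / (φ ⊗ ψ)(y⋆y)`, over all states `φ, ψ` of `A` and all
`y ∈ A ⊗ A` with `(φ ⊗ ψ)(y⋆y) ≠ 0` (that is, the supremum of the norms of the operators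
`(π_φ ⊗ π_ψ)(x)`, with `π_φ, π_ψ` the GNS representations). -/
def SpatialNormLE (x : A ⊗[ℂ] A) (C : ℝ) : Prop :=
  ∀ φ ψ : A →L[ℂ] ℂ, IsState φ → IsState ψ → ∀ y : A ⊗[ℂ] A,
    (tensorFunctional φ ψ (star (x * y) * (x * y))).re ≤
      C ^ 2 * (tensorFunctional φ ψ (star y * y)).re

end Functionals

/-- A closed subgroup `G ⊂ S_N^+` (a quantum permutation group), given by its algebra `A = C(G)`
and by its magic unitary `u = (u_ij)`. The algebra `A` is a unital `C⋆`-algebra generated by the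
entries of a magic unitary (that is, a quotient of the universal algebra `C(S_N^+)`), in such a way
that `u_ij ↦ ∑ₖ u_ik ⊗ u_kj` defines a morphism of `C⋆`-algebras `Δ : A → A ⊗ A`, the target being
the minimal `C⋆`-tensor product.

Such a `Δ` is recorded by its restriction to the dense `⋆`-subalgebra generated by the entries
of `u`, which takes values in the algebraic tensor product: this is a `⋆`-morphism, and `Δ` exists
(and is then unique) precisely when this `⋆`-morphism is contractive from the norm of `A` to the
minimal tensor norm. -/
structure ClosedQuantumSubgroup (N : ℕ) (A : Type*) [CStarAlgebra A] where
  /-- the magic unitary, whose entries are the standard coordinates -/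
  u : Matrix (Fin N) (Fin N) A
  magic : IsMagicUnitary u
  dense : Dense (StarAlgebra.adjoin ℂ (Set.range fun p : Fin N × Fin N => u p.1 p.2) : Set A)
  /-- the comultiplication, on the dense subalgebra generated by the coordinates -/
  comul : StarAlgebra.adjoin ℂ (Set.range fun p : Fin N × Fin N => u p.1 p.2) →⋆ₐ[ℂ] A ⊗[ℂ] A
  comul_coord : ∀ i j, comul ⟨u i j, StarAlgebra.subset_adjoin ℂ _ ⟨(i, j), rfl⟩⟩ =
    ∑ k, u i k ⊗ₜ[ℂ] u k j
  comul_bound : ∀ a, SpatialNormLE (comul a) ‖(a : A)‖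

namespace ClosedQuantumSubgroup

variable {N : ℕ} {A : Type*} [CStarAlgebra A] (G : ClosedQuantumSubgroup N A)

/-- The dense `⋆`-subalgebra of `C(G)` generated by the standard coordinates. -/
abbrev polyAlg : StarSubalgebra ℂ A :=
  StarAlgebra.adjoin ℂ (Set.range fun p : Fin N × Fin N => G.u p.1 p.2)

/-- A Haar state on `C(G)`: a state which is left and right invariant,
`(φ ⊗ id)Δ(a) = φ(a)1 = (id ⊗ φ)Δ(a)`. By continuity, it is enough to have these formulae on the
dense subalgebra. -/
structure IsHaarState (φ : A →L[ℂ] ℂ) : Prop where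
  isState : IsState φ
  left_inv : ∀ a : G.polyAlg, sliceLeft φ (G.comul a) = φ a • (1 : A)
  right_inv : ∀ a : G.polyAlg, sliceRight φ (G.comul a) = φ a • (1 : A)

/-- The product `u_{i₁j₁} u_{i₂j₂} … u_{iₖjₖ}`, in this order. -/
def monomial {k : ℕ} (i j : Fin k → Fin N) : A :=
  (List.ofFn fun r => G.u (i r) (j r)).prod

end ClosedQuantumSubgroup

/-! ### Existence and uniqueness of the Haar state, needed in order to define the integration -/

section States

variable {A : Type*} [CStarAlgebra A]

theorem positive_functional_aux {B : Type*} [Ring B] [StarRing B] [Algebra ℂ B] [StarModule ℂ B]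
    (f : B →ₗ[ℂ] ℂ) (h1 : f 1 = 1) (hf : ∀ b, 0 ≤ f (star b * b)) :
    (∀ b, f (star b) = star (f b)) ∧ ∀ b, ‖f b‖ ^ 2 ≤ (f (star b * b)).re := by
  have key : ∀ b (c : ℂ), f (star (b - c • 1) * (b - c • 1)) =
      f (star b * b) - c * f (star b) - star c * f b + star c * c := by
    intro b c
    simp only [star_sub, star_smul, star_one, sub_mul, mul_sub, smul_mul_assoc, one_mul,
      mul_smul_comm, mul_one, map_sub, map_smul, smul_eq_mul, h1]
    ring
  have hstar : ∀ b, f (star b) = star (f b) := by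
    intro b
    have h0 := (Complex.le_def.1 (hf b)).2
    have e1 := (Complex.le_def.1 (hf (b - (1 : ℂ) • 1))).2
    have e2 := (Complex.le_def.1 (hf (b - Complex.I • 1))).2
    rw [key] at e1 e2
    simp at h0 e1 e2
    apply Complex.ext
    · simp
      linarith
    · simp
      linarith
  refine ⟨hstar, fun b => ?_⟩
  have h := (Complex.le_def.1 (hf (b - (f b) • 1))).1
  rw [key, hstar] at h
  rw [← Complex.normSq_eq_norm_sq, Complex.normSq_apply]
  simp at h
  linarith

theorem IsState.map_star {φ : A →L[ℂ] ℂ} (h : IsState φ) (a : A) : φ (star a) = star (φ a) :=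
  (positive_functional_aux φ.toLinearMap h.map_one h.nonneg).1 a

theorem IsState.cauchy_schwarz {φ : A →L[ℂ] ℂ} (h : IsState φ) (a : A) :
    ‖φ a‖ ^ 2 ≤ (φ (star a * a)).re :=
  (positive_functional_aux φ.toLinearMap h.map_one h.nonneg).2 a

theorem IsState.le_norm {φ : A →L[ℂ] ℂ} (h : IsState φ) (a : A) : ‖φ a‖ ≤ ‖a‖ := by
  let _ := CStarAlgebra.spectralOrder A
  have _ := CStarAlgebra.spectralOrderedRing A
  have h1 := h.cauchy_schwarz a
  have h2 : star a * a ≤ algebraMap ℝ A (‖a‖ ^ 2) := CStarAlgebra.star_mul_le_algebraMap_norm_sq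
  obtain ⟨c, hc⟩ := CStarAlgebra.nonneg_iff_eq_star_mul_self.1 (sub_nonneg.2 h2)
  have h3 := (Complex.le_def.1 (h.nonneg c)).1
  rw [← hc, map_sub, IsScalarTower.algebraMap_apply ℝ ℂ A, Algebra.algebraMap_eq_smul_one,
    map_smul, h.map_one] at h3
  simp [-Complex.ofReal_pow] at h3
  exact le_of_sq_le_sq (h1.trans h3) (norm_nonneg a)

theorem exists_state_ne_zero {a : A} (ha : a ≠ 0) :
    ∃ φ : A →L[ℂ] ℂ, IsState φ ∧ φ (star a * a) ≠ 0 := by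
  let _ := CStarAlgebra.spectralOrder A
  have _ := CStarAlgebra.spectralOrderedRing A
  let C : ProperCone ℝ A := ProperCone.positive ℝ A
  have hnot : -(star a * a) ∉ C := by
    intro h
    have h' : 0 ≤ -(star a * a) := by simpa [C] using h
    have : star a * a = 0 := le_antisymm (neg_nonneg.1 h') (star_mul_self_nonneg a)
    exact ha ((CStarRing.star_mul_self_eq_zero_iff a).1 this)
  obtain ⟨f, hf, hfa⟩ := C.hyperplane_separation_point hnot
  have hf' : ∀ b : A, 0 ≤ f (star b * b) := fun b => hf _ (by simp [C])
  have hfpos : 0 < f (star a * a) := by simpa using hfa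
  have hf1 : 0 < f 1 := by
    have h2 : star a * a ≤ algebraMap ℝ A (‖a‖ ^ 2) := CStarAlgebra.star_mul_le_algebraMap_norm_sq
    have h3 := hf _ (by simpa [C] using sub_nonneg.2 h2 : algebraMap ℝ A (‖a‖ ^ 2) - star a * a ∈ C)
    rw [map_sub, Algebra.algebraMap_eq_smul_one, map_smul, smul_eq_mul] at h3
    by_contra hneg
    nlinarith [sq_nonneg ‖a‖]
  let g : A →L[ℝ] ℝ := f + f.comp (starL' ℝ : A ≃L[ℝ] A).toContinuousLinearMap
  let φ : A →L[ℂ] ℂ := StrongDual.extendRCLike g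
  have hφ : ∀ b : A, φ b = (f b + f (star b) : ℝ) -
      Complex.I * (f (Complex.I • b) + f (star (Complex.I • b)) : ℝ) := by
    intro b
    simp [φ, g, StrongDual.extendRCLike_apply]
  have hsa : ∀ b : A, star b = b → φ b = ((2 * f b : ℝ) : ℂ) := by
    intro b hb
    rw [hφ, star_smul, hb]
    simp
    ring
  have hφ1 : φ 1 = ((2 * f 1 : ℝ) : ℂ) := hsa 1 (star_one A)
  refine ⟨((2 * f 1 : ℝ) : ℂ)⁻¹ • φ, ⟨?_, fun b => ?_⟩, ?_⟩
  · have : ((2 * f 1 : ℝ) : ℂ) ≠ 0 := by exact_mod_cast (by positivity : (2 * f 1 : ℝ) ≠ 0)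
    simp only [FunLike.coe_smul, Pi.smul_apply, hφ1, smul_eq_mul]
    exact inv_mul_cancel₀ this
  · simp only [FunLike.coe_smul, Pi.smul_apply, smul_eq_mul]
    rw [hsa _ (by simp), ← Complex.ofReal_inv, ← Complex.ofReal_mul]
    have := hf' b
    exact_mod_cast (by positivity : (0 : ℝ) ≤ (2 * f 1)⁻¹ * (2 * f (star b * b)))
  · simp only [FunLike.coe_smul, Pi.smul_apply, smul_eq_mul]
    rw [hsa _ (by simp), ← Complex.ofReal_inv, ← Complex.ofReal_mul]
    exact_mod_cast (by positivity : (2 * f 1)⁻¹ * (2 * f (star a * a)) ≠ 0)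

theorem tensorFunctional_tmul (φ ψ : A →L[ℂ] ℂ) (a b : A) :
    tensorFunctional φ ψ (a ⊗ₜ b) = φ a * ψ b := by
  simp [tensorFunctional]

theorem IsState.gram_posSemidef {φ : A →L[ℂ] ℂ} (h : IsState φ) {n : ℕ} (a : Fin n → A) :
    (Matrix.of fun i j => φ (star (a i) * a j)).PosSemidef := by
  refine Matrix.PosSemidef.of_dotProduct_mulVec_nonneg ?_ ?_
  · ext i j
    simp [Matrix.conjTranspose_apply, ← h.map_star]
  · intro x
    have := h.nonneg (∑ j, x j • a j)
    convert this using 1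
    simp [dotProduct, Matrix.mulVec, Finset.sum_mul, Finset.mul_sum, map_sum]
    rw [Finset.sum_comm]
    exact Finset.sum_congr rfl fun i _ => Finset.sum_congr rfl fun j _ => by ring

theorem tensorFunctional_nonneg {φ ψ : A →L[ℂ] ℂ} (h : IsState φ) (h' : IsState ψ)
    (x : A ⊗[ℂ] A) : 0 ≤ tensorFunctional φ ψ (star x * x) := by
  obtain ⟨n, a, b, rfl⟩ : ∃ (n : ℕ) (a b : Fin n → A), x = ∑ i, a i ⊗ₜ[ℂ] b i := by
    obtain ⟨s, rfl⟩ := TensorProduct.exists_finset x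
    exact ⟨s.card, fun i => (s.equivFin.symm i).1.1, fun i => (s.equivFin.symm i).1.2, by
      rw [← Finset.sum_coe_sort s, ← Equiv.sum_comp s.equivFin.symm]⟩
  have := ((h.gram_posSemidef a).kronecker (h'.gram_posSemidef b)).dotProduct_mulVec_nonneg
    (fun p => if p.1 = p.2 then 1 else 0)
  convert this using 1
  simp [dotProduct, Matrix.mulVec, Fintype.sum_prod_type, Finset.sum_mul, Finset.mul_sum, map_sum,
    tensorFunctional_tmul, apply_ite, ite_mul]
  rw [Finset.sum_comm]

/-- If a state fixes a vector `ξ` through a unitary matrix `V`, then it vanishes on the squares of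
the coordinates of `Vξ - ξ`. -/
theorem IsState.fixed_vector {φ : A →L[ℂ] ℂ} (h : IsState φ) {ι : Type*} [Fintype ι]
    [DecidableEq ι] (V : ι → ι → A)
    (hV : ∀ l m, ∑ i, star (V i l) * V i m = if l = m then 1 else 0)
    (ξ : ι → ℂ) (hξ : ∀ i, ∑ l, φ (V i l) * ξ l = ξ i) (i : ι) :
    φ (star (∑ l, ξ l • V i l - ξ i • 1) * (∑ l, ξ l • V i l - ξ i • 1)) = 0 := by
  have hsum : ∑ i, φ (star (∑ l, ξ l • V i l - ξ i • 1) * (∑ l, ξ l • V i l - ξ i • 1)) = 0 := by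
    have e1 : ∀ i, φ (star (∑ l, ξ l • V i l - ξ i • 1) * (∑ l, ξ l • V i l - ξ i • 1)) =
        φ (star (∑ l, ξ l • V i l) * (∑ l, ξ l • V i l)) - star (ξ i) * ξ i := by
      intro i
      have e2 : φ (∑ l, ξ l • V i l) = ξ i := by
        rw [← hξ i, map_sum]
        exact Finset.sum_congr rfl fun l _ => by rw [map_smul, smul_eq_mul, mul_comm]
      have e3 : φ (star (∑ l, ξ l • V i l)) = star (ξ i) := by rw [h.map_star, e2]
      generalize (∑ l, ξ l • V i l) = x at e2 e3 ⊢
      simp only [star_sub, star_smul, star_one, sub_mul, mul_sub, smul_mul_assoc, one_mul,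
        mul_smul_comm, mul_one, map_sub, map_smul, smul_eq_mul, h.map_one, e2, e3]
      ring
    rw [Finset.sum_congr rfl fun i _ => e1 i, Finset.sum_sub_distrib, ← map_sum, sub_eq_zero]
    have e4 : ∑ i, star (∑ l, ξ l • V i l) * (∑ l, ξ l • V i l) = ∑ i, (star (ξ i) * ξ i) • 1 := by
      calc _ = ∑ i, ∑ l, ∑ m, (star (ξ l) * ξ m) • (star (V i l) * V i m) := by
            refine Finset.sum_congr rfl fun i _ => ?_
            rw [star_sum, Finset.sum_mul_sum]
            refine Finset.sum_congr rfl fun l _ => Finset.sum_congr rfl fun m _ => ?_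
            rw [star_smul, smul_mul_smul_comm]
        _ = ∑ l, ∑ m, (star (ξ l) * ξ m) • ∑ i, (star (V i l) * V i m) := by
            rw [Finset.sum_comm]
            refine Finset.sum_congr rfl fun l _ => ?_
            rw [Finset.sum_comm]
            simp only [Finset.smul_sum]
        _ = _ := by simp [hV]
    rw [e4, map_sum]
    simp [h.map_one]
  exact (Finset.sum_eq_zero_iff_of_nonneg fun i _ => h.nonneg _).1 hsum i (Finset.mem_univ i)

theorem IsMagicUnitary.mul_eq_zero {ι : Type*} [Fintype ι] {p : ι → A}
    (hp : ∀ i, IsStarProjection (p i)) (hs : ∑ i, p i = 1) {l m : ι} (h : l ≠ m) :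
    p l * p m = 0 := by
  classical
  let _ := CStarAlgebra.spectralOrder A
  have _ := CStarAlgebra.spectralOrderedRing A
  have h1 : ∑ i ∈ Finset.univ.erase m, star (p i * p m) * (p i * p m) = 0 := by
    have h2 : ∀ i, star (p i * p m) * (p i * p m) = p m * p i * p m := by
      intro i
      rw [star_mul, (hp i).isSelfAdjoint.star_eq, (hp m).isSelfAdjoint.star_eq, mul_assoc,
        ← mul_assoc (p i), (hp i).isIdempotentElem.eq, mul_assoc]
    have h3 : ∑ i, p m * p i * p m = p m := by
      rw [← Finset.sum_mul, ← Finset.mul_sum, hs, mul_one, (hp m).isIdempotentElem.eq]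
    rw [← Finset.add_sum_erase _ _ (Finset.mem_univ m), (hp m).isIdempotentElem.eq,
      (hp m).isIdempotentElem.eq] at h3
    simp only [h2]
    simpa using h3
  have h4 := (Finset.sum_eq_zero_iff_of_nonneg fun i _ => star_mul_self_nonneg (p i * p m)).1 h1 l
    (by simp [h])
  exact (CStarRing.star_mul_self_eq_zero_iff _).1 h4

end States

namespace ClosedQuantumSubgroup

variable {N : ℕ} {A : Type*} [CStarAlgebra A] (G : ClosedQuantumSubgroup N A)

theorem star_u (i j : Fin N) : star (G.u i j) = G.u i j :=
  (G.magic.projection i j).isSelfAdjoint.star_eq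

theorem u_mul_row (i l m : Fin N) : G.u i l * G.u i m = if l = m then G.u i l else 0 := by
  split_ifs with h
  · rw [h]; exact (G.magic.projection i m).isIdempotentElem.eq
  · exact IsMagicUnitary.mul_eq_zero (fun j => G.magic.projection i j) (G.magic.row_sum i) h

theorem u_mul_col (j l m : Fin N) : G.u l j * G.u m j = if l = m then G.u l j else 0 := by
  split_ifs with h
  · rw [h]; exact (G.magic.projection m j).isIdempotentElem.eq
  · exact IsMagicUnitary.mul_eq_zero (p := fun i => G.u i j)
      (fun i => G.magic.projection i j) (G.magic.col_sum j) h

theorem monomial_succ {k : ℕ} (i j : Fin (k + 1) → Fin N) :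
    G.monomial i j = G.u (i 0) (j 0) * G.monomial (fun r => i r.succ) (fun r => j r.succ) := by
  simp [monomial, List.ofFn_succ]

theorem monomial_zero (i j : Fin 0 → Fin N) : G.monomial i j = 1 := by
  simp [monomial]

theorem sum_tuple_succ {k : ℕ} {M : Type*} [AddCommMonoid M] (f : (Fin (k + 1) → Fin N) → M) :
    ∑ i, f i = ∑ a : Fin N, ∑ i : Fin k → Fin N, f (Fin.cons a i) := by
  rw [← (Fin.consEquiv fun _ : Fin (k + 1) => Fin N).sum_comp, Fintype.sum_prod_type]
  rfl

theorem monomial_unitary_col {k : ℕ} (l m : Fin k → Fin N) :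
    ∑ i, star (G.monomial i l) * G.monomial i m = if l = m then 1 else 0 := by
  induction k with
  | zero => simp [monomial_zero, Subsingleton.elim l m]
  | succ k ih =>
    rw [sum_tuple_succ]
    simp only [monomial_succ, Fin.cons_zero, Fin.cons_succ, star_mul, star_u]
    have h1 : ∀ (a : Fin N) (i : Fin k → Fin N),
        star (G.monomial i fun r => l r.succ) * G.u a (l 0) *
          (G.u a (m 0) * G.monomial i fun r => m r.succ) =
        star (G.monomial i fun r => l r.succ) * (if l 0 = m 0 then G.u a (l 0) else 0) *
          G.monomial i fun r => m r.succ := by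
      intro a i
      rw [← G.u_mul_row]
      simp only [mul_assoc]
    simp only [h1]
    rw [Finset.sum_comm]
    simp only [← Finset.sum_mul, ← Finset.mul_sum]
    have h2 : (∑ a, if l 0 = m 0 then G.u a (l 0) else 0) = if l 0 = m 0 then 1 else 0 := by
      split_ifs
      · exact G.magic.col_sum _
      · simp
    rw [h2]
    have h3 : (l = m) ↔ (l 0 = m 0 ∧ (fun r : Fin k => l r.succ) = fun r => m r.succ) := by
      simp [funext_iff, Fin.forall_fin_succ]
    by_cases h0 : l 0 = m 0
    · simp [h0, ih, h3]
    · simp [h0, h3]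

theorem monomial_unitary_row {k : ℕ} (l m : Fin k → Fin N) :
    ∑ j, G.monomial l j * star (G.monomial m j) = if l = m then 1 else 0 := by
  induction k with
  | zero => simp [monomial_zero, Subsingleton.elim l m]
  | succ k ih =>
    rw [sum_tuple_succ]
    simp only [monomial_succ, Fin.cons_zero, Fin.cons_succ, star_mul, star_u]
    have h1 : ∀ (a : Fin N) (i : Fin k → Fin N),
        G.u (l 0) a * G.monomial (fun r => l r.succ) i *
          (star (G.monomial (fun r => m r.succ) i) * G.u (m 0) a) =
        G.u (l 0) a * (G.monomial (fun r => l r.succ) i *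
          star (G.monomial (fun r => m r.succ) i)) * G.u (m 0) a := by
      intro a i
      simp only [mul_assoc]
    simp only [h1, ← Finset.sum_mul, ← Finset.mul_sum, ih]
    have h3 : (l = m) ↔ (l 0 = m 0 ∧ (fun r : Fin k => l r.succ) = fun r => m r.succ) := by
      simp [funext_iff, Fin.forall_fin_succ]
    by_cases h0 : (fun r : Fin k => l r.succ) = fun r => m r.succ
    · simp only [h0, if_true, mul_one, h3, and_true, u_mul_col]
      split_ifs
      · exact G.magic.row_sum _
      · simp
    · simp [h0, h3]

theorem monomial_mem {k : ℕ} (i j : Fin k → Fin N) : G.monomial i j ∈ G.polyAlg := by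
  refine list_prod_mem fun x hx => ?_
  obtain ⟨r, rfl⟩ := (List.mem_ofFn' _ _).1 hx
  exact StarAlgebra.subset_adjoin ℂ _ ⟨(i r, j r), rfl⟩

theorem polyAlg_eq_span : Subalgebra.toSubmodule G.polyAlg.toSubalgebra =
    Submodule.span ℂ {a | ∃ (k : ℕ) (i j : Fin k → Fin N), a = G.monomial i j} := by
  rw [StarAlgebra.adjoin_eq_span]
  apply le_antisymm
  · refine Submodule.span_mono ?_
    intro x hx
    obtain ⟨L, hL, rfl⟩ := Submonoid.exists_list_of_mem_closure hx
    have hL' : ∀ y ∈ L, ∃ p : Fin N × Fin N, G.u p.1 p.2 = y := by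
      intro y hy
      rcases hL y hy with h | h
      · exact h
      · obtain ⟨p, hp⟩ := h
        exact ⟨p, by rw [← star_star y, ← hp, star_u]⟩
    refine ⟨L.length, fun r => (hL' _ (L.get_mem r)).choose.1,
      fun r => (hL' _ (L.get_mem r)).choose.2, ?_⟩
    unfold monomial
    congr 1
    conv_lhs => rw [← List.ofFn_get L]
    congr 1
    funext r
    exact (hL' _ (L.get_mem r)).choose_spec.symm
  · refine Submodule.span_le.2 ?_
    rintro x ⟨k, i, j, rfl⟩
    have := G.monomial_mem i j
    rw [← SetLike.mem_coe, ← StarSubalgebra.coe_toSubalgebra] at this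
    rw [← StarAlgebra.adjoin_eq_span]
    exact this

theorem polyAlg_ext {M : Type*} [AddCommGroup M] [Module ℂ M] {f g : G.polyAlg →ₗ[ℂ] M}
    (h : ∀ (k : ℕ) (i j : Fin k → Fin N), f ⟨G.monomial i j, G.monomial_mem i j⟩ =
      g ⟨G.monomial i j, G.monomial_mem i j⟩) : f = g := by
  ext ⟨a, ha⟩
  have ha' : a ∈ Submodule.span ℂ {a | ∃ (k : ℕ) (i j : Fin k → Fin N), a = G.monomial i j} := by
    rw [← G.polyAlg_eq_span]; exact ha
  have hle : ∀ b ∈ Submodule.span ℂ {a | ∃ (k : ℕ) (i j : Fin k → Fin N), a = G.monomial i j},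
      b ∈ G.polyAlg := by
    intro b hb
    rw [← G.polyAlg_eq_span] at hb; exact hb
  suffices H : ∀ hb : a ∈ G.polyAlg, f ⟨a, hb⟩ = g ⟨a, hb⟩ from H ha
  induction ha' using Submodule.span_induction with
  | mem x hx => obtain ⟨k, i, j, rfl⟩ := hx; exact fun _ => h k i j
  | zero => intro hb; exact (map_zero f).trans (map_zero g).symm
  | add x y hx hy h1 h2 =>
    intro hb
    have e : (⟨x + y, hb⟩ : G.polyAlg) = ⟨x, hle x hx⟩ + ⟨y, hle y hy⟩ := rfl
    rw [e, map_add, map_add, h1 (hle x hx), h2 (hle y hy)]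
  | smul c x hx h1 =>
    intro hb
    have e : (⟨c • x, hb⟩ : G.polyAlg) = c • ⟨x, hle x hx⟩ := rfl
    rw [e, map_smul, map_smul, h1 (hle x hx)]

theorem functional_ext {φ ψ : A →L[ℂ] ℂ} (h : ∀ (k : ℕ) (i j : Fin k → Fin N),
    φ (G.monomial i j) = ψ (G.monomial i j)) : φ = ψ := by
  have h1 : φ.toLinearMap ∘ₗ G.polyAlg.toSubalgebra.val.toLinearMap =
      ψ.toLinearMap ∘ₗ G.polyAlg.toSubalgebra.val.toLinearMap :=
    G.polyAlg_ext fun k i j => h k i j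
  apply ContinuousLinearMap.coeFn_injective
  refine Continuous.ext_on G.dense φ.continuous ψ.continuous fun a ha => ?_
  exact LinearMap.congr_fun h1 ⟨a, ha⟩

theorem comul_monomial {k : ℕ} (i j : Fin k → Fin N) :
    G.comul ⟨G.monomial i j, G.monomial_mem i j⟩ =
      ∑ l, G.monomial i l ⊗ₜ[ℂ] G.monomial l j := by
  induction k with
  | zero =>
    have e : (⟨G.monomial i j, G.monomial_mem i j⟩ : G.polyAlg) = 1 :=
      Subtype.ext (G.monomial_zero i j)
    rw [e, map_one]
    simp [monomial_zero, Algebra.TensorProduct.one_def]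
  | succ k ih =>
    have e : (⟨G.monomial i j, G.monomial_mem i j⟩ : G.polyAlg) =
        ⟨G.u (i 0) (j 0), StarAlgebra.subset_adjoin ℂ _ ⟨(i 0, j 0), rfl⟩⟩ *
          ⟨G.monomial (fun r => i r.succ) (fun r => j r.succ), G.monomial_mem _ _⟩ :=
      Subtype.ext (G.monomial_succ i j)
    rw [e, map_mul, ih, comul_coord, Finset.sum_mul_sum, sum_tuple_succ]
    simp [monomial_succ]

theorem exists_convolution {φ ψ : A →L[ℂ] ℂ} (hφ : IsState φ) (hψ : IsState ψ) :
    ∃ χ : A →L[ℂ] ℂ, IsState χ ∧ ∀ (k : ℕ) (i j : Fin k → Fin N),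
      χ (G.monomial i j) = ∑ l, φ (G.monomial i l) * ψ (G.monomial l j) := by
  have hpos := tensorFunctional_nonneg hφ hψ
  have h1 : tensorFunctional φ ψ 1 = 1 := by
    rw [Algebra.TensorProduct.one_def, tensorFunctional_tmul, hφ.map_one, hψ.map_one, mul_one]
  have hcs := (positive_functional_aux (tensorFunctional φ ψ) h1 hpos).2
  let f₀ : G.polyAlg →ₗ[ℂ] ℂ := tensorFunctional φ ψ ∘ₗ G.comul.toAlgHom.toLinearMap
  have hf₀ : ∀ a, f₀ a = tensorFunctional φ ψ (G.comul a) := fun a => rfl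
  have hb : ∀ a : G.polyAlg, ‖f₀ a‖ ≤ 1 * ‖a‖ := by
    intro a
    have h2 := G.comul_bound a φ ψ hφ hψ 1
    rw [mul_one, star_one, mul_one, h1, Complex.one_re, mul_one] at h2
    rw [one_mul]
    exact le_of_sq_le_sq ((hcs (G.comul a)).trans h2) (norm_nonneg _)
  let f : G.polyAlg →L[ℂ] ℂ := f₀.mkContinuous 1 hb
  let e : G.polyAlg →L[ℂ] A := G.polyAlg.toSubalgebra.toSubmodule.subtypeL
  have he : DenseRange e := by
    have : Set.range e = (G.polyAlg : Set A) := Subtype.range_coe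
    rw [DenseRange, this]
    exact G.dense
  have hu : IsUniformInducing e := isUniformEmbedding_subtype_val.isUniformInducing
  let χ : A →L[ℂ] ℂ := f.extend e
  have hχ : ∀ a : G.polyAlg, χ (a : A) = tensorFunctional φ ψ (G.comul a) := fun a =>
    ContinuousLinearMap.extend_eq f he hu a
  refine ⟨χ, ⟨?_, ?_⟩, ?_⟩
  · have := hχ 1
    rw [map_one, h1] at this
    exact this
  · intro a
    refine G.dense.induction (P := fun a => 0 ≤ χ (star a * a)) ?_ ?_ a
    · intro x hx
      have := hχ (star ⟨x, hx⟩ * ⟨x, hx⟩)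
      rw [map_mul, map_star] at this
      have h3 := hpos (G.comul ⟨x, hx⟩)
      rw [← this] at h3
      exact h3
    · exact isClosed_le continuous_const
        (χ.continuous.comp (continuous_star.mul continuous_id))
  · intro k i j
    have := hχ ⟨G.monomial i j, G.monomial_mem i j⟩
    rw [comul_monomial, map_sum] at this
    simpa only [tensorFunctional_tmul] using this

theorem isCompact_states : IsCompact {φ : WeakDual ℂ A | IsState (WeakDual.toStrongDual φ)} := by
  refine (WeakDual.isCompact_closedBall (0 : StrongDual ℂ A) 1).of_isClosed_subset ?_ ?_
  · have e : {φ : WeakDual ℂ A | IsState (WeakDual.toStrongDual φ)} =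
        {φ : WeakDual ℂ A | φ 1 = 1} ∩ ⋂ a : A, {φ : WeakDual ℂ A | 0 ≤ φ (star a * a)} := by
      ext φ
      simp only [Set.mem_inter_iff, Set.mem_iInter]
      exact ⟨fun h => ⟨h.1, h.2⟩, fun h => ⟨h.1, h.2⟩⟩
    rw [e]
    exact (isClosed_eq (WeakDual.eval_continuous _) continuous_const).inter
      (isClosed_iInter fun a => isClosed_le continuous_const (WeakDual.eval_continuous _))
  · intro φ hφ
    have h : IsState (WeakDual.toStrongDual φ) := hφ
    rw [Set.mem_preimage, mem_closedBall_zero_iff]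
    exact ContinuousLinearMap.opNorm_le_bound _ zero_le_one fun a => by
      rw [one_mul]; exact h.le_norm a

/-- Cesàro limits of convolution powers. -/
theorem exists_convolution_fixed {φ : A →L[ℂ] ℂ} (hφ : IsState φ) :
    ∃ χ : A →L[ℂ] ℂ, IsState χ ∧ ∀ (k : ℕ) (i j : Fin k → Fin N),
      (∑ l, φ (G.monomial i l) * χ (G.monomial l j) = χ (G.monomial i j)) ∧
      (∑ l, χ (G.monomial i l) * φ (G.monomial l j) = χ (G.monomial i j)) := by
  let M : (k : ℕ) → Matrix (Fin k → Fin N) (Fin k → Fin N) ℂ := fun k =>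
    Matrix.of fun i j => φ (G.monomial i j)
  have hp : ∀ n : ℕ, ∃ p : A →L[ℂ] ℂ, IsState p ∧ ∀ (k : ℕ) (i j : Fin k → Fin N),
      p (G.monomial i j) = (M k ^ (n + 1)) i j := by
    intro n
    induction n with
    | zero => exact ⟨φ, hφ, fun k i j => by simp [M]⟩
    | succ n ih =>
      obtain ⟨p, hps, hpm⟩ := ih
      obtain ⟨q, hqs, hqm⟩ := G.exists_convolution hφ hps
      refine ⟨q, hqs, fun k i j => ?_⟩
      rw [hqm, pow_succ', Matrix.mul_apply]
      exact Finset.sum_congr rfl fun l _ => by rw [hpm]; rfl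
  choose p hps hpm using hp
  let c : ℕ → ℂ := fun n => ((n : ℂ) + 1)⁻¹
  let q : ℕ → A →L[ℂ] ℂ := fun n => c n • ∑ r ∈ Finset.range (n + 1), p r
  have hq : ∀ n a, q n a = c n * ∑ r ∈ Finset.range (n + 1), p r a := by
    intro n a
    simp [q]
  have hqs : ∀ n, IsState (q n) := by
    intro n
    constructor
    · rw [hq, Finset.sum_congr rfl fun r _ => (hps r).map_one]
      have : (n : ℂ) + 1 ≠ 0 := by exact_mod_cast n.succ_ne_zero
      simp [c, this]
    · intro a
      rw [hq]
      have h2 : 0 ≤ c n := by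
        have : (0 : ℝ) ≤ ((n : ℝ) + 1)⁻¹ := by positivity
        have h3 : c n = (((n : ℝ) + 1)⁻¹ : ℝ) := by simp [c]
        rw [h3]
        exact_mod_cast this
      exact mul_nonneg h2 (Finset.sum_nonneg fun r _ => (hps r).nonneg a)
  have hqM : ∀ n k, (Matrix.of fun i j => q n (G.monomial i j)) =
      c n • ∑ r ∈ Finset.range (n + 1), M k ^ (r + 1) := by
    intro n k
    ext i j
    simp [hq, hpm, Matrix.sum_apply]
  have hl : ∀ n k, M k * (c n • ∑ r ∈ Finset.range (n + 1), M k ^ (r + 1)) -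
      c n • ∑ r ∈ Finset.range (n + 1), M k ^ (r + 1) = c n • (M k ^ (n + 2) - M k ^ 1) := by
    intro n k
    rw [mul_smul_comm, ← smul_sub, Finset.mul_sum, ← Finset.sum_sub_distrib]
    simp only [← pow_succ']
    rw [Finset.sum_range_sub (fun r => M k ^ (r + 1)) (n + 1)]
  have hr : ∀ n k, (c n • ∑ r ∈ Finset.range (n + 1), M k ^ (r + 1)) * M k -
      c n • ∑ r ∈ Finset.range (n + 1), M k ^ (r + 1) = c n • (M k ^ (n + 2) - M k ^ 1) := by
    intro n k
    rw [smul_mul_assoc, ← smul_sub, Finset.sum_mul, ← Finset.sum_sub_distrib]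
    simp only [← pow_succ]
    rw [Finset.sum_range_sub (fun r => M k ^ (r + 1)) (n + 1)]
  have hlim : ∀ (k : ℕ) (i j : Fin k → Fin N),
      Filter.Tendsto (fun n => (c n • (M k ^ (n + 2) - M k ^ 1)) i j)
        (Filter.hyperfilter ℕ : Filter ℕ) (nhds 0) := by
    intro k i j
    refine Filter.Tendsto.mono_left ?_ Nat.hyperfilter_le_atTop
    refine squeeze_zero_norm (a := fun n : ℕ => 1 / ((n : ℝ) + 1) * (2 * ‖G.monomial i j‖)) ?_ ?_
    · intro n
      have h1 : ‖p (n + 1) (G.monomial i j)‖ ≤ ‖G.monomial i j‖ := (hps _).le_norm _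
      have h2 : ‖p 0 (G.monomial i j)‖ ≤ ‖G.monomial i j‖ := (hps _).le_norm _
      rw [hpm] at h1 h2
      have h3 : ‖c n‖ = 1 / ((n : ℝ) + 1) := by
        have : c n = (((n : ℝ) + 1)⁻¹ : ℝ) := by simp [c]
        rw [this, Complex.norm_real, Real.norm_of_nonneg (by positivity), one_div]
      rw [Matrix.smul_apply, norm_smul, h3, Matrix.sub_apply]
      refine mul_le_mul_of_nonneg_left ?_ (by positivity)
      refine (norm_sub_le _ _).trans ?_
      linarith
    · simpa using tendsto_one_div_add_atTop_nhds_zero_nat.mul_const (2 * ‖G.monomial i j‖)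
  obtain ⟨χ, hχ, hle⟩ := (isCompact_states (A := A)).ultrafilter_le_nhds
    ((Filter.hyperfilter ℕ).map fun n => StrongDual.toWeakDual (q n)) (by
      rw [Filter.le_principal_iff]
      exact Filter.mem_map.2 (Filter.univ_mem' hqs))
  have hev : ∀ a : A, Filter.Tendsto (fun n => q n a) (Filter.hyperfilter ℕ : Filter ℕ)
      (nhds (χ a)) := fun a =>
    ((WeakDual.eval_continuous a).tendsto χ).comp
      (show Filter.Tendsto (fun n => StrongDual.toWeakDual (q n)) _ (nhds χ) from hle)
  refine ⟨WeakDual.toStrongDual χ, hχ, fun k i j => ⟨?_, ?_⟩⟩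
  · have h1 : Filter.Tendsto (fun n => ∑ l, φ (G.monomial i l) * q n (G.monomial l j) -
        q n (G.monomial i j)) (Filter.hyperfilter ℕ : Filter ℕ)
        (nhds (∑ l, φ (G.monomial i l) * χ (G.monomial l j) - χ (G.monomial i j))) :=
      (tendsto_finsetSum _ fun l _ => (hev _).const_mul _).sub (hev _)
    have h2 := hlim k i j
    simp only [← hl, ← hqM] at h2
    exact sub_eq_zero.1 (tendsto_nhds_unique h1 h2)
  · have h1 : Filter.Tendsto (fun n => ∑ l, q n (G.monomial i l) * φ (G.monomial l j) -
        q n (G.monomial i j)) (Filter.hyperfilter ℕ : Filter ℕ)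
        (nhds (∑ l, χ (G.monomial i l) * φ (G.monomial l j) - χ (G.monomial i j))) :=
      (tendsto_finsetSum _ fun l _ => (hev _).mul_const _).sub (hev _)
    have h2 := hlim k i j
    simp only [← hr, ← hqM] at h2
    exact sub_eq_zero.1 (tendsto_nhds_unique h1 h2)

/-- The states `χ` such that `φ * χ = χ = χ * φ`. -/
def absorbing (φ : A →L[ℂ] ℂ) : Set (WeakDual ℂ A) :=
  {χ | IsState (WeakDual.toStrongDual χ) ∧ ∀ (k : ℕ) (i j : Fin k → Fin N),
      (∑ l, φ (G.monomial i l) * χ (G.monomial l j) = χ (G.monomial i j)) ∧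
      (∑ l, χ (G.monomial i l) * φ (G.monomial l j) = χ (G.monomial i j))}

theorem absorbing_left {φ : A →L[ℂ] ℂ} (hφ : IsState φ) {χ : WeakDual ℂ A}
    (hχ : χ ∈ G.absorbing φ) {k : ℕ} (i j : Fin k → Fin N) :
    let x := ∑ l, χ (G.monomial l j) • G.monomial i l - χ (G.monomial i j) • 1
    φ (star x * x) = 0 :=
  hφ.fixed_vector (fun i l => G.monomial i l) (fun l m => G.monomial_unitary_col l m)
    (fun l => χ (G.monomial l j)) (fun i => (hχ.2 k i j).1) i

theorem absorbing_right {φ : A →L[ℂ] ℂ} (hφ : IsState φ) {χ : WeakDual ℂ A}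
    (hχ : χ ∈ G.absorbing φ) {k : ℕ} (i j : Fin k → Fin N) :
    let x := ∑ l, star (χ (G.monomial i l)) • star (G.monomial l j) -
      star (χ (G.monomial i j)) • 1
    φ (star x * x) = 0 :=
  hφ.fixed_vector (fun j l => star (G.monomial l j))
    (fun l m => by simpa using G.monomial_unitary_row l m)
    (fun l => star (χ (G.monomial i l))) (fun j => by
      rw [← (hχ.2 k i j).2, star_sum]
      refine Finset.sum_congr rfl fun l _ => ?_
      rw [hφ.map_star, star_mul']
      exact mul_comm _ _) j

theorem exists_isHaarState [Nontrivial A] : ∃ φ : A →L[ℂ] ℂ, G.IsHaarState φ := by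
  obtain ⟨χ, hχ⟩ : (⋂ φ : {φ : A →L[ℂ] ℂ // IsState φ}, G.absorbing φ.1).Nonempty := by
    have hne : Nonempty {φ : A →L[ℂ] ℂ // IsState φ} := by
      obtain ⟨φ, h, -⟩ := exists_state_ne_zero (one_ne_zero (α := A))
      exact ⟨⟨φ, h⟩⟩
    have hclosed : ∀ φ : {φ : A →L[ℂ] ℂ // IsState φ}, IsCompact (G.absorbing φ.1) := by
      intro φ
      refine isCompact_states.inter_right ?_
      have e : ∀ p : (k : ℕ) → (Fin k → Fin N) → (Fin k → Fin N) → WeakDual ℂ A → Prop,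
          (∀ k i j, IsClosed {χ | p k i j χ}) → IsClosed {χ | ∀ k i j, p k i j χ} := by
        intro p hp
        have : {χ | ∀ k i j, p k i j χ} = ⋂ k, ⋂ i, ⋂ j, {χ | p k i j χ} := by
          ext χ
          simp
        rw [this]
        exact isClosed_iInter fun k => isClosed_iInter fun i => isClosed_iInter fun j => hp k i j
      refine e _ fun k i j => ?_
      refine IsClosed.inter (isClosed_eq ?_ ?_) (isClosed_eq ?_ ?_)
      · exact continuous_finsetSum _ fun l _ => continuous_const.mul (WeakDual.eval_continuous _)
      · exact WeakDual.eval_continuous _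
      · exact continuous_finsetSum _ fun l _ => (WeakDual.eval_continuous _).mul continuous_const
      · exact WeakDual.eval_continuous _
    refine IsCompact.nonempty_iInter_of_directed_nonempty_isCompact_isClosed _ ?_ ?_ hclosed
      fun φ => (hclosed φ).isClosed
    · rintro ⟨φ, hφ⟩ ⟨ψ, hψ⟩
      have hmid : ∀ a, ((2 : ℂ)⁻¹ • (φ + ψ)) a = 2⁻¹ * (φ a + ψ a) := fun a => rfl
      have hst : IsState ((2 : ℂ)⁻¹ • (φ + ψ)) := by
        constructor
        · rw [hmid, hφ.map_one, hψ.map_one]; norm_num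
        · intro a
          rw [hmid]
          have h2 : (0 : ℂ) ≤ 2⁻¹ := by
            rw [inv_nonneg]; norm_num
          exact mul_nonneg h2 (add_nonneg (hφ.nonneg a) (hψ.nonneg a))
      have hz : ∀ x, ((2 : ℂ)⁻¹ • (φ + ψ)) (star x * x) = 0 → φ x = 0 ∧ ψ x = 0 := by
        intro x hx
        rw [hmid] at hx
        have h3 : φ (star x * x) + ψ (star x * x) = 0 := by simpa using hx
        rw [add_eq_zero_iff_of_nonneg (hφ.nonneg x) (hψ.nonneg x)] at h3
        have h4 := hφ.cauchy_schwarz x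
        have h5 := hψ.cauchy_schwarz x
        rw [h3.1] at h4
        rw [h3.2] at h5
        simp at h4 h5
        exact ⟨h4, h5⟩
      have key : ∀ θ : A →L[ℂ] ℂ, IsState θ →
          (∀ x, ((2 : ℂ)⁻¹ • (φ + ψ)) (star x * x) = 0 → θ x = 0) →
          G.absorbing ((2 : ℂ)⁻¹ • (φ + ψ)) ⊆ G.absorbing θ := by
        intro θ hθ h0 χ hχ
        refine ⟨hχ.1, fun k i j => ⟨?_, ?_⟩⟩
        · have := h0 _ (G.absorbing_left hst hχ i j)
          rw [map_sub, map_sum, map_smul, hθ.map_one, smul_eq_mul, mul_one, sub_eq_zero] at this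
          rw [← this]
          exact Finset.sum_congr rfl fun l _ => by rw [map_smul, smul_eq_mul, mul_comm]
        · have := h0 _ (G.absorbing_right hst hχ i j)
          rw [map_sub, map_sum, map_smul, hθ.map_one, smul_eq_mul, mul_one, sub_eq_zero] at this
          rw [← star_inj, ← this, star_sum]
          exact Finset.sum_congr rfl fun l _ => by
            rw [map_smul, smul_eq_mul, star_mul', hθ.map_star]
      exact ⟨⟨_, hst⟩, key φ hφ fun x hx => (hz x hx).1, key ψ hψ fun x hx => (hz x hx).2⟩
    · rintro ⟨φ, hφ⟩
      obtain ⟨χ, h, h'⟩ := G.exists_convolution_fixed hφ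
      exact ⟨StrongDual.toWeakDual χ, h, h'⟩
  rw [Set.mem_iInter] at hχ
  have hz : ∀ x : A, (∀ φ : A →L[ℂ] ℂ, IsState φ → φ (star x * x) = 0) → x = 0 := by
    intro x hx
    by_contra h
    obtain ⟨φ, h1, h2⟩ := exists_state_ne_zero h
    exact h2 (hx φ h1)
  obtain ⟨φ₀, h₀, -⟩ := exists_state_ne_zero (one_ne_zero (α := A))
  let η : A →L[ℂ] ℂ := WeakDual.toStrongDual χ
  refine ⟨η, (hχ ⟨φ₀, h₀⟩).1, ?_, ?_⟩
  · suffices H : sliceLeft η ∘ₗ G.comul.toAlgHom.toLinearMap =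
        (LinearMap.toSpanSingleton ℂ A 1) ∘ₗ η.toLinearMap ∘ₗ
          G.polyAlg.toSubalgebra.toSubmodule.subtype from fun a => LinearMap.congr_fun H a
    refine G.polyAlg_ext fun k i j => ?_
    have h1 := hz _ fun φ hφ => G.absorbing_right hφ (hχ ⟨φ, hφ⟩) i j
    change sliceLeft η (G.comul _) = η (G.monomial i j) • (1 : A)
    rw [comul_monomial, map_sum]
    rw [sub_eq_zero, ← star_inj] at h1
    simp only [star_sum, star_smul, star_star, star_one] at h1
    simp only [sliceLeft, LinearMap.comp_apply, TensorProduct.map_tmul]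
    exact h1
  · suffices H : sliceRight η ∘ₗ G.comul.toAlgHom.toLinearMap =
        (LinearMap.toSpanSingleton ℂ A 1) ∘ₗ η.toLinearMap ∘ₗ
          G.polyAlg.toSubalgebra.toSubmodule.subtype from fun a => LinearMap.congr_fun H a
    refine G.polyAlg_ext fun k i j => ?_
    have h1 := hz _ fun φ hφ => G.absorbing_left hφ (hχ ⟨φ, hφ⟩) i j
    change sliceRight η (G.comul _) = η (G.monomial i j) • (1 : A)
    rw [comul_monomial, map_sum]
    rw [sub_eq_zero] at h1
    simp only [sliceRight, LinearMap.comp_apply, TensorProduct.map_tmul]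
    exact h1

theorem IsHaarState.unique {φ ψ : A →L[ℂ] ℂ} (hφ : G.IsHaarState φ) (hψ : G.IsHaarState ψ) :
    φ = ψ := by
  refine G.functional_ext fun k i j => ?_
  have h1 := congrArg ψ (hφ.left_inv ⟨G.monomial i j, G.monomial_mem i j⟩)
  have h2 := congrArg φ (hψ.right_inv ⟨G.monomial i j, G.monomial_mem i j⟩)
  rw [comul_monomial, map_sum, map_sum, map_smul, hψ.isState.map_one] at h1
  rw [comul_monomial, map_sum, map_sum, map_smul, hφ.isState.map_one] at h2
  simp only [sliceLeft, sliceRight, LinearMap.comp_apply, TensorProduct.map_tmul,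
    LinearEquiv.coe_coe, TensorProduct.lid_tmul, TensorProduct.rid_tmul, map_smul, smul_eq_mul,
    LinearMap.id_apply, mul_one, ContinuousLinearMap.coe_coe] at h1 h2
  rw [← h1, ← h2]
  exact Finset.sum_congr rfl fun l _ => mul_comm _ _

/-- The Haar integration `∫_G : C(G) → ℂ`, namely the unique Haar state of `C(G)`. -/
noncomputable def haar [Nontrivial A] : A →L[ℂ] ℂ := G.exists_isHaarState.choose

theorem haar_isHaarState [Nontrivial A] : G.IsHaarState G.haar := G.exists_isHaarState.choose_spec

end ClosedQuantumSubgroup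

/-! ### The coaction on the span of the tuples with distinct consecutive entries -/

/-- The set `J_N^k` of the tuples `(i₁, …, iₖ) ∈ {1, …, N}^k` such that `i₁ ≠ i₂ ≠ … ≠ iₖ`, in the
sense that any two consecutive entries are distinct. -/
abbrev ConsecDistinct (N k : ℕ) : Type :=
  {i : Fin k → Fin N // ∀ r s : Fin k, s.val = r.val + 1 → i r ≠ i s}

/-- The vector space `span(J_N^k)`, with basis `e_i = Finsupp.single i 1`, for `i ∈ J_N^k`. -/
abbrev SpanJ (N k : ℕ) : Type := ConsecDistinct N k →₀ ℂ

/-- The all-one vector `η = ∑_{i ∈ J_N^k} e_i`. -/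
noncomputable def allOne (N k : ℕ) : SpanJ N k := ∑ i, Finsupp.single i 1

namespace ClosedQuantumSubgroup

variable {N : ℕ} {A : Type*} [CStarAlgebra A] (G : ClosedQuantumSubgroup N A)

/-- The coaction `Φ : (ℂ^N)^{⊗k} → C(G) ⊗ (ℂ^N)^{⊗k}`, given by
`Φ(e_{i₁…iₖ}) = ∑_{j₁…jₖ} u_{i₁j₁}…u_{iₖjₖ} ⊗ e_{j₁…jₖ}`. Here `(ℂ^N)^{⊗k}` is the vector space
with basis `e_{i₁…iₖ}`, indexed by all the tuples. -/
noncomputable def tensorCoaction (k : ℕ) :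
    ((Fin k → Fin N) →₀ ℂ) →ₗ[ℂ] A ⊗[ℂ] ((Fin k → Fin N) →₀ ℂ) :=
  Finsupp.linearCombination ℂ fun i => ∑ j, G.monomial i j ⊗ₜ[ℂ] Finsupp.single j 1

/-- The coaction `Φ : span(J_N^k) → C(G) ⊗ span(J_N^k)`, given by
`Φ(e_{i₁…iₖ}) = ∑_{j ∈ J_N^k} u_{i₁j₁}…u_{iₖjₖ} ⊗ e_{j₁…jₖ}`. This is the restriction of the
coaction on `(ℂ^N)^{⊗k}`, as shown right below. -/
noncomputable def coaction (k : ℕ) : SpanJ N k →ₗ[ℂ] A ⊗[ℂ] SpanJ N k :=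
  Finsupp.linearCombination ℂ fun i => ∑ j, G.monomial i.1 j.1 ⊗ₜ[ℂ] Finsupp.single j 1

theorem monomial_eq_zero {k : ℕ} (i j : Fin k → Fin N) (r s : Fin k) (hrs : s.val = r.val + 1)
    (hi : i r ≠ i s) (hj : j r = j s) : G.monomial i j = 0 := by
  induction k with
  | zero => exact r.elim0
  | succ k ih =>
    rw [monomial_succ]
    obtain ⟨s', rfl⟩ := Fin.exists_succ_eq.2 (show s ≠ 0 by rintro rfl; simp at hrs)
    cases r using Fin.cases with
    | zero =>
      cases k with
      | zero => exact s'.elim0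
      | succ k =>
        obtain rfl : s' = 0 := Fin.ext (by simpa using hrs)
        rw [monomial_succ, ← mul_assoc, hj, u_mul_col, if_neg hi, zero_mul]
    | succ r' =>
      rw [ih _ _ r' s' (by simpa using hrs) hi hj, mul_zero]

/-- The space `span(J_N^k)` is invariant under the coaction on `(ℂ^N)^{⊗k}`, the restriction being
the coaction `Φ` above. -/
theorem tensorCoaction_restrict (k : ℕ) :
    G.tensorCoaction k ∘ₗ Finsupp.lmapDomain ℂ ℂ Subtype.val =
      (Finsupp.lmapDomain ℂ ℂ Subtype.val).lTensor A ∘ₗ G.coaction k := by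
  refine Finsupp.lhom_ext' fun i => LinearMap.ext_ring ?_
  simp only [tensorCoaction, coaction, LinearMap.comp_apply, Finsupp.lsingle_apply,
    Finsupp.lmapDomain_apply, Finsupp.mapDomain_single, Finsupp.linearCombination_single, one_smul,
    map_sum, LinearMap.lTensor_tmul]
  symm
  refine Finset.sum_of_injOn Subtype.val Subtype.val_injective.injOn (fun _ _ => Finset.mem_coe.2
    (Finset.mem_univ _)) (fun j _ hj => ?_) (fun _ _ => rfl)
  have : ¬ ∀ r s : Fin k, s.val = r.val + 1 → j r ≠ j s := fun h => hj ⟨⟨j, h⟩, by simp, rfl⟩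
  push Not at this
  obtain ⟨r, s, hrs, hj'⟩ := this
  rw [G.monomial_eq_zero i.1 j r s hrs (i.2 r s hrs) hj', TensorProduct.zero_tmul]

/-- The fixed point space `Fix(Φ) = {ξ | Φ(ξ) = 1 ⊗ ξ}`. -/
noncomputable def fix (k : ℕ) : Submodule ℂ (SpanJ N k) :=
  LinearMap.eqLocus (G.coaction k) (TensorProduct.mk ℂ A (SpanJ N k) 1)

end ClosedQuantumSubgroup

/-! For tuples `i`, `j` write `u_ij` for the product `u_{i₁j₁} ⋯ u_{iₖjₖ}`. The equivalence of
conditions 1 and 3 is the quantum form of the fact that the multiplicity of the trivial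
representation is the integral of the character. The operator `P = (∫ ⊗ id)Φ` on `span(J_N^k)` is a
projection onto `Fix(Φ)` (`IsHaarState.isProj_average`). Its trace is therefore `dim Fix(Φ)`, and
computed in the basis `e_i` this trace is the sum of the integrals of the `u_ii` (`trace_average`).

That `P` takes values in `Fix(Φ)` is left invariance: with `Δ(u_ij) = ∑ₗ u_il ⊗ u_lj`, it says `∑ₗ
∫u_il · u_lj = ∫u_ij · 1`. That `P` is the identity on `Fix(Φ)` is just `∫1 = 1`.

Invariance and the magic relations give sums over all tuples, while `Φ` only sees tuples in `J_N^k`.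
The two match because entries of `u` in the same row or column are orthogonal, so that `u_ij = 0` as
soon as exactly one of `i`, `j` lies in `J_N^k` (`monomial_eq_zero`, `monomial_eq_zero'`). The same
remark, together with the column sums, shows that `η` is fixed. So `Fix(Φ)` always contains the line
`ℂη`, and conditions 1 and 2 both say that it contains nothing more. -/

theorem LinearMap.IsProj.trace_eq_finrank {K V : Type*} [Field K] [AddCommGroup V] [Module K V]
    [FiniteDimensional K V] {p : Submodule K V} {f : V →ₗ[K] V} (h : LinearMap.IsProj p f) :
    LinearMap.trace K V f = (Module.finrank K p : K) :=
  h.trace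

/-! ### Vanishing of monomials off `J_N^k`, and their column sums -/

namespace ClosedQuantumSubgroup

variable {N : ℕ} {A : Type*} [CStarAlgebra A] (G : ClosedQuantumSubgroup N A)

/-- Two neighbouring factors share a row and have distinct columns, hence are orthogonal
projections. This is the mirror image of `monomial_eq_zero`: there the column tuple leaves `J_N^k`,
here the row tuple does, which is what summing over `i` in `Φ(η)` requires. -/
theorem monomial_eq_zero' {k : ℕ} (i j : Fin k → Fin N) (r s : Fin k) (hrs : s.val = r.val + 1)
    (hi : i r = i s) (hj : j r ≠ j s) : G.monomial i j = 0 := by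
  induction k with
  | zero => exact r.elim0
  | succ k ih =>
    rw [monomial_succ]
    obtain ⟨s', rfl⟩ := Fin.exists_succ_eq.2 (show s ≠ 0 by rintro rfl; simp at hrs)
    -- Either the repetition sits in the first two places, where the two leading factors multiply to
    -- zero, or the first factor can be peeled off and the induction hypothesis kills the tail.
    cases r using Fin.cases with
    | zero =>
      cases k with
      | zero => exact s'.elim0
      | succ k =>
        obtain rfl : s' = 0 := Fin.ext (by simpa using hrs)
        rw [monomial_succ, ← mul_assoc, hi, u_mul_row, if_neg hj, zero_mul]
    | succ r' =>
      rw [ih _ _ r' s' (by simpa using hrs) hi hj, mul_zero]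

/-- A sum over `J_N^k` equals the sum over all the tuples, if the summand vanishes outside
`J_N^k`. -/
theorem sum_consecDistinct {k : ℕ} {M : Type*} [AddCommMonoid M] (f : (Fin k → Fin N) → M)
    (h : ∀ (i : Fin k → Fin N) (r s : Fin k), s.val = r.val + 1 → i r = i s → f i = 0) :
    ∑ i : ConsecDistinct N k, f i.1 = ∑ i, f i := by
  refine Finset.sum_of_injOn Subtype.val Subtype.val_injective.injOn (fun _ _ => Finset.mem_coe.2
    (Finset.mem_univ _)) (fun j _ hj => ?_) (fun _ _ => rfl)
  -- A tuple not coming from the subtype must violate its defining condition.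
  have : ¬ ∀ r s : Fin k, s.val = r.val + 1 → j r ≠ j s := fun h => hj ⟨⟨j, h⟩, by simp, rfl⟩
  push Not at this
  obtain ⟨r, s, hrs, hj'⟩ := this
  exact h j r s hrs hj'

/-- The sum telescopes from the right: summing over the tail of `i` first gives `1` by induction,
which leaves a single column sum of `u`. -/
theorem sum_monomial_left {k : ℕ} (j : Fin k → Fin N) : ∑ i, G.monomial i j = 1 := by
  induction k with
  | zero => simp [monomial_zero]
  | succ k ih =>
    rw [sum_tuple_succ]
    simp only [monomial_succ, Fin.cons_zero, Fin.cons_succ, ← Finset.mul_sum, ih, mul_one]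
    exact G.magic.col_sum _

/-! ### The coaction on basis vectors, and the fixed vector `η` -/

theorem coaction_single {k : ℕ} (i : ConsecDistinct N k) :
    G.coaction k (Finsupp.single i 1) = ∑ j, G.monomial i.1 j.1 ⊗ₜ[ℂ] Finsupp.single j 1 := by
  simp [coaction]

/-- The coefficient of `e_j` in `Φ(η)` is the sum of the `u_ij` over `i ∈ J_N^k`. Since `j ∈ J_N^k`,
the tuples outside `J_N^k` would contribute zero, so this is a full column sum. -/
theorem coaction_allOne (k : ℕ) : G.coaction k (allOne N k) = 1 ⊗ₜ[ℂ] allOne N k := by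
  rw [allOne, map_sum, TensorProduct.tmul_sum]
  simp only [coaction_single]
  rw [Finset.sum_comm]
  refine Finset.sum_congr rfl fun j _ => ?_
  rw [← TensorProduct.sum_tmul,
    sum_consecDistinct (fun i => G.monomial i j.1) fun i r s hrs hi =>
      G.monomial_eq_zero' i j.1 r s hrs hi (j.2 r s hrs),
    sum_monomial_left]

theorem mem_fix {k : ℕ} {ξ : SpanJ N k} : ξ ∈ G.fix k ↔ G.coaction k ξ = 1 ⊗ₜ[ℂ] ξ :=
  Iff.rfl

/-! ### Haar averaging and the dimension of `Fix(Φ)` -/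

/-- Left invariance, read on `Δ(u_ij) = ∑ₗ u_il ⊗ u_lj`. -/
theorem IsHaarState.sum_smul_monomial {φ : A →L[ℂ] ℂ} (hφ : G.IsHaarState φ) {k : ℕ}
    (i j : Fin k → Fin N) :
    ∑ l, φ (G.monomial i l) • G.monomial l j = φ (G.monomial i j) • (1 : A) := by
  have h := hφ.left_inv ⟨G.monomial i j, G.monomial_mem i j⟩
  rw [comul_monomial, map_sum] at h
  simpa [sliceLeft] using h

/-- The averaging operator `(φ ⊗ id)Φ` on `span(J_N^k)`. -/
noncomputable def average (φ : A →L[ℂ] ℂ) (k : ℕ) : SpanJ N k →ₗ[ℂ] SpanJ N k :=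
  (TensorProduct.lid ℂ (SpanJ N k)).toLinearMap ∘ₗ
    φ.toLinearMap.rTensor (SpanJ N k) ∘ₗ G.coaction k

theorem average_single (φ : A →L[ℂ] ℂ) {k : ℕ} (i : ConsecDistinct N k) :
    G.average φ k (Finsupp.single i 1) =
      ∑ j : ConsecDistinct N k, φ (G.monomial i.1 j.1) • Finsupp.single j 1 := by
  simp only [average, LinearMap.comp_apply, coaction_single, map_sum, LinearMap.rTensor_tmul,
    LinearEquiv.coe_coe, TensorProduct.lid_tmul, ContinuousLinearMap.coe_coe]

/-- In the basis `e_i` the matrix entries of the averaging operator are the numbers `φ(u_ij)`, up to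
transposition, which the diagonal does not see. No invariance of `φ` is involved. -/
theorem trace_average (φ : A →L[ℂ] ℂ) (k : ℕ) :
    LinearMap.trace ℂ _ (G.average φ k) =
      ∑ i : ConsecDistinct N k, φ (G.monomial i.1 i.1) := by
  classical
  rw [LinearMap.trace_eq_matrix_trace ℂ Finsupp.basisSingleOne, Matrix.trace]
  refine Finset.sum_congr rfl fun i _ => ?_
  rw [Matrix.diag_apply, LinearMap.toMatrix_apply, Finsupp.coe_basisSingleOne, average_single]
  simp [Finsupp.single_apply]

/-- Averaging with respect to a Haar state is a projection onto the fixed point space. -/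
theorem IsHaarState.isProj_average {φ : A →L[ℂ] ℂ} (hφ : G.IsHaarState φ) (k : ℕ) :
    LinearMap.IsProj (G.fix k) (G.average φ k) := by
  refine ⟨fun ξ => ?_, fun ξ hξ => ?_⟩
  · rw [mem_fix]
    suffices H : G.coaction k ∘ₗ G.average φ k =
        TensorProduct.mk ℂ A (SpanJ N k) 1 ∘ₗ G.average φ k from LinearMap.congr_fun H ξ
    refine Finsupp.lhom_ext' fun i => LinearMap.ext_ring ?_
    simp only [LinearMap.comp_apply, Finsupp.lsingle_apply, average_single, map_sum, map_smul,
      coaction_single, TensorProduct.mk_apply, Finset.smul_sum]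
    -- Exchanging the sums isolates the coefficient of each `e_j` in `Φ(P e_i)`, namely the sum over
    -- `l ∈ J_N^k` of `φ(u_il) u_lj`.
    rw [Finset.sum_comm]
    refine Finset.sum_congr rfl fun j _ => ?_
    simp only [TensorProduct.smul_tmul']
    -- Invariance needs the sum over all `l`; the added terms vanish because `i ∈ J_N^k` forces
    -- `u_il = 0` when `l ∉ J_N^k`.
    rw [← TensorProduct.sum_tmul, sum_consecDistinct
      (fun l => φ (G.monomial i.1 l) • G.monomial l j.1) fun l r s hrs hl => by
        rw [G.monomial_eq_zero i.1 l r s hrs (i.2 r s hrs) hl, map_zero, zero_smul],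
      hφ.sum_smul_monomial G]
  -- On a fixed vector, `(φ ⊗ id)(1 ⊗ ξ) = φ(1)ξ = ξ`.
  · simp only [average, LinearMap.comp_apply, G.mem_fix.1 hξ, LinearMap.rTensor_tmul,
      LinearEquiv.coe_coe, TensorProduct.lid_tmul, ContinuousLinearMap.coe_coe,
      hφ.isState.map_one, one_smul]

/-- The dimension of the fixed point space is the integral of the character of the coaction. -/
theorem IsHaarState.finrank_fix {φ : A →L[ℂ] ℂ} (hφ : G.IsHaarState φ) (k : ℕ) :
    (Module.finrank ℂ (G.fix k) : ℂ) =
      ∑ i : ConsecDistinct N k, φ (G.monomial i.1 i.1) := by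
  rw [← trace_average]
  exact (hφ.isProj_average G k).trace_eq_finrank.symm

end ClosedQuantumSubgroup

/-! ### The equivalence -/

/-- This is where `J_N^k ≠ ∅` enters. For empty `J_N^k` both `Fix(Φ)` and `ℂη` would be zero, so
condition 2 would hold and condition 1 fail. -/
theorem allOne_ne_zero {N k : ℕ} (hJ : Nonempty (ConsecDistinct N k)) : allOne N k ≠ 0 := by
  classical
  obtain ⟨i⟩ := hJ
  intro h
  have := DFunLike.congr_fun h i
  simp [allOne, Finsupp.single_apply] at this

theorem proposition4p2 {N k : ℕ} {A : Type*} [CStarAlgebra A] [Nontrivial A]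
    (G : ClosedQuantumSubgroup N A) (hJ : Nonempty (ConsecDistinct N k)) :
    G.coaction k (allOne N k) = 1 ⊗ₜ[ℂ] allOne N k ∧
    List.TFAE [
      Module.finrank ℂ (G.fix k) = 1,
      G.fix k = Submodule.span ℂ {allOne N k},
      ∑ i : ConsecDistinct N k, G.haar (G.monomial i.1 i.1) = 1] := by
  have hη := G.coaction_allOne k
  have hne := allOne_ne_zero hJ
  refine ⟨hη, ?_⟩
  -- The line `ℂη` lies in `Fix(Φ)`, so equality of dimensions gives equality of spaces.
  tfae_have 1 → 2 := fun h =>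
    (Submodule.eq_of_le_of_finrank_eq
      ((Submodule.span_singleton_le_iff_mem _ _).2 (G.mem_fix.2 hη))
      (by rw [h, finrank_span_singleton hne])).symm
  tfae_have 2 → 1 := fun h => by rw [h, finrank_span_singleton hne]
  tfae_have 1 ↔ 3 := by
    -- The sum of integrals is the dimension viewed in `ℂ`, and the cast from `ℕ` is injective.
    rw [← G.haar_isHaarState.finrank_fix G k, Nat.cast_eq_one]
  tfae_finish
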